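/- A numerical semigroup is a subset $\Lambda\subseteq\mathbb{N}_0$ that contains $0$, is closed under addition, and has finite complement. Its multiplicity is $m(\Lambda)=\min(\Lambda\setminus\{0\})$, its conductor is $c(\Lambda)=\min\{c\in\mathbb{N}_0 : c+\mathbb{N}_0\subseteq\Lambda\}$, its Frobenius number is $c(\Lambda)-1$, and its depth is $\lceil c(\Lambda)/m(\Lambda)\rceil$. For integers $q,f$ let $\operatorname{Fr}_q(f)$ be the number of numerical semigroups with Frobenius number $f$ and depth $q$, and for $q\ge 1$ let $c_q=\sqrt{\lfloor (q+2)^2/4\rfloor}$. Then for every fixed integer $q\ge 2$, $$\operatorname{Fr}_q(f)=(c_{q-1})^{\,f/(q-1)+o(f)}\qquad\text{as } f\to\infty;$$ that is, there is a function $\varepsilon:\mathbb{N}_0\to\mathbb{R}$ (depending on $q$) with $\varepsilon(f)/f\to 0$ as $f\to\infty$ such that $\operatorname{Fr}_q(f)=(c_{q-1})^{f/(q-1)+\varepsilon(f)}$ for all sufficiently large $f$. -/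

import Mathlib

open Filter Asymptotics

/-- A numerical semigroup: an additive submonoid of `ℕ` (so it contains `0`) with finite
complement. -/
def IsNumericalSemigroup (Λ : AddSubmonoid ℕ) : Prop :=
  ((Λ : Set ℕ)ᶜ).Finite

namespace IsNumericalSemigroup

/-- The multiplicity: the least nonzero element. -/
noncomputable def multiplicity (Λ : AddSubmonoid ℕ) : ℕ :=
  sInf {n : ℕ | n ∈ Λ ∧ n ≠ 0}

/-- The conductor: the least `c` with `c + ℕ ⊆ Λ`. -/
noncomputable def conductor (Λ : AddSubmonoid ℕ) : ℕ :=
  sInf {c : ℕ | ∀ n : ℕ, c + n ∈ Λ}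

/-- The Frobenius number, `c - 1`; an integer, as it equals `-1` for `Λ = ℕ`. -/
noncomputable def frobenius (Λ : AddSubmonoid ℕ) : ℤ :=
  (conductor Λ : ℤ) - 1

/-- The depth, `⌈c / m⌉`. -/
noncomputable def depth (Λ : AddSubmonoid ℕ) : ℕ :=
  ⌈(conductor Λ : ℚ) / (multiplicity Λ : ℚ)⌉₊

end IsNumericalSemigroup

/-- `Fr_q(f)`: the number of numerical semigroups with Frobenius number `f` and depth `q`. -/
noncomputable def frobeniusDepthCount (q f : ℕ) : ℕ :=
  Set.ncard {Λ : AddSubmonoid ℕ | IsNumericalSemigroup Λ ∧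
    IsNumericalSemigroup.frobenius Λ = (f : ℤ) ∧ IsNumericalSemigroup.depth Λ = q}

/-- The constant `c_q = √⌊(q + 2)² / 4⌋`. -/
noncomputable def depthConst (q : ℕ) : ℝ :=
  Real.sqrt (⌊((q : ℝ) + 2) ^ 2 / 4⌋₊ : ℝ)

/-! Write `q = n + 1` and let `m` be the multiplicity, so `n * m ≤ f`. Kunz coordinates describe a
semigroup by how many elements of `[0, f]` it has in each class mod `m`.

Upper bound: the trace on `[0, f]` is closed under sums that stay in range. By the container lemma
`exists_container` it lies between two sets that depend only on a fingerprint `(A, P)`. For a large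
constant `φ` there are few fingerprints, and the cardinalities of the two sets differ by little more
than `f / 2`. Between them, a trace is fixed by its class counts, which leaves at most `∏ (d i + 1)`
choices with `∑ d i` about `f / 2`. Concavity of `log (x + 1)`, through its chord on `[s, s + 1]`
with `s = n / 2`, bounds this product. The bound grows with `m`, and at `m = f / n` it is
`depthConst n ^ (f / n)` up to the error terms.

Lower bound: if all elements not divisible by `m` exceed `f / 2`, closure under addition is
automatic. The Kunz coordinates can then be chosen independently, with `s + 1` values on about half
of the classes and `n - s + 1` on the others. -/

/-! ### Containers for sum-closed subsets of `[0, f]`. -/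

section Containers

open Finset
open scoped Pointwise

/-- A set of sums `P + A` with `P ⊆ L` sparse that contains most of every translate
`x + A` with `x ∈ L`. -/
lemma exists_sparse_cover {φ : ℕ} (hφ : 0 < φ) (A L : Finset ℕ) :
    ∃ P ⊆ L, #P * φ ≤ #(P + A) ∧ ∀ x ∈ L, #(({x} + A) \ (P + A)) < φ := by
  obtain ⟨P, hP, hmax⟩ := exists_max_image
    (L.powerset.filter fun P => #P * φ ≤ #(P + A)) card ⟨∅, by simp⟩
  simp only [mem_filter, mem_powerset] at hP hmax
  refine ⟨P, hP.1, hP.2, fun x hx => ?_⟩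
  -- A translate with `φ` new elements could be added to `P`, against its maximality.
  by_contra! h
  have hxP : x ∉ P := fun hxP => by
    have : ({x} + A) \ (P + A) = ∅ :=
      sdiff_eq_empty_iff_subset.2 (add_subset_add_right (singleton_subset_iff.2 hxP))
    rw [this, card_empty] at h
    omega
  have hsum : insert x P + A = (P + A) ∪ (({x} + A) \ (P + A)) := by
    rw [union_sdiff_self_eq_union, insert_eq, union_add, union_comm]
  have := hmax (insert x P) ⟨insert_subset hx hP.1, by
    rw [hsum, card_union_of_disjoint disjoint_sdiff, card_insert_of_notMem hxP, add_mul, one_mul]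
    omega⟩
  rw [card_insert_of_notMem hxP] at this
  omega

/-- The elements forced to be present by the fingerprint `(A, P)`. -/
def containerLower (φ : ℕ) (A P : Finset ℕ) : Finset ℕ :=
  if #A = φ ^ 2 then P + A else ∅

/-- The elements of `[0, f]` allowed by the fingerprint `(A, P)`. -/
def containerUpper (φ f : ℕ) (A P : Finset ℕ) : Finset ℕ :=
  Ioc (f / 2) f ∪
    if #A = φ ^ 2 then (range (f / 2 + 1)).filter fun x => #(({x} + A) \ (P + A)) < φ else A

/-- Double count pairs `(x, u)` with `u ∈ (x + A) ∩ U`: each `x ∈ D` has at least `φ ^ 2 - φ`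
partners, and each `u` at most `#A`, one per difference `u - x ∈ A`. -/
lemma card_mul_le_of_translates_covered {φ : ℕ} {A U D : Finset ℕ} (hA : #A = φ ^ 2)
    (hD : ∀ x ∈ D, #(({x} + A) \ U) < φ) : #D * (φ ^ 2 - φ) ≤ #U * φ ^ 2 := by
  refine card_mul_le_card_mul (fun x u => u ∈ ({x} : Finset ℕ) + A) (fun x hx => ?_)
    (fun u _ => ?_)
  · have h1 : #(({x} : Finset ℕ) + A) = φ ^ 2 := by rw [card_singleton_add, hA]
    have h2 := card_sdiff_add_card_inter (({x} : Finset ℕ) + A) U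
    have h3 := hD x hx
    have h4 : U.bipartiteAbove (fun x u => u ∈ ({x} : Finset ℕ) + A) x = ({x} + A) ∩ U := by
      ext u; simp [bipartiteAbove, and_comm]
    rw [h4]
    omega
  · have key : ∀ x ∈ D.bipartiteBelow (fun x u => u ∈ ({x} : Finset ℕ) + A) u,
        ∃ a ∈ A, x + a = u := fun x hx => by
      obtain ⟨y, hy, a, ha, h⟩ := mem_add.1 (mem_filter.1 hx).2
      exact ⟨a, ha, mem_singleton.1 hy ▸ h⟩
    rw [← hA]
    refine card_le_card_of_injOn (fun x => u - x) (fun x hx => ?_) (fun x hx y hy hxy => ?_)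
    · obtain ⟨a, ha, h⟩ := key x hx
      have : u - x = a := by omega
      simpa [this] using ha
    · obtain ⟨a, -, h⟩ := key x hx
      obtain ⟨b, -, h'⟩ := key y hy
      simp only at hxy
      omega

/-- Sums of two elements of the low half `L` stay within `f`, so `P + A` is forced into `T`. The
candidates for `L` have most of their translate of `A` inside `P + A`, so they barely outnumber it.
Only the high half contributes substantially to the gap. -/
lemma exists_container {φ f : ℕ} (hφ : 2 ≤ φ) {T : Finset ℕ} (hTf : T ⊆ range (f + 1))
    (hT : ∀ x ∈ T, ∀ y ∈ T, x + y ≤ f → x + y ∈ T) :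
    ∃ A P : Finset ℕ, A ⊆ range (f + 1) ∧ P ⊆ range (f + 1) ∧ #A ≤ φ ^ 2 ∧ #P * φ ≤ f + 1 ∧
      containerLower φ A P ⊆ T ∧ T ⊆ containerUpper φ f A P ∧
      (#(containerUpper φ f A P) : ℝ) ≤
        #(containerLower φ A P) + ((f + 1) / 2 + φ ^ 2 + (f + 1) / (φ - 1)) := by
  have hφ' : (0 : ℝ) < φ - 1 := by
    have : (2 : ℝ) ≤ φ := by exact_mod_cast hφ
    linarith
  have hhigh : (#(Ioc (f / 2) f) : ℝ) ≤ (f + 1) / 2 := by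
    rw [Nat.card_Ioc, le_div_iff₀ (by norm_num)]
    exact_mod_cast (by omega : (f - f / 2) * 2 ≤ f + 1)
  set L := T.filter (· ≤ f / 2) with hL
  have hLT : L ⊆ T := filter_subset _ _
  have hsplit : ∀ x ∈ T, x ∉ L → x ∈ Ioc (f / 2) f := fun x hx hxL => by
    have := mem_range.1 (hTf hx)
    simp only [hL, mem_filter, not_and, not_le] at hxL
    exact mem_Ioc.2 ⟨hxL hx, by omega⟩
  -- When `L` is small it serves as its own fingerprint. Strictness makes `#A = φ ^ 2` a flag
  -- telling the two cases apart.
  by_cases hcard : #L < φ ^ 2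
  · refine ⟨L, ∅, hLT.trans hTf, by simp, hcard.le, by simp, ?_, ?_, ?_⟩
    · simp [containerLower, hcard.ne]
    · intro x hx
      rw [containerUpper, if_neg hcard.ne, mem_union]
      by_cases h : x ∈ L
      · exact Or.inr h
      · exact Or.inl (hsplit x hx h)
    · rw [containerUpper, if_neg hcard.ne, containerLower, if_neg hcard.ne]
      have h1 : (#(Ioc (f / 2) f ∪ L) : ℝ) ≤ #(Ioc (f / 2) f) + #L := by
        exact_mod_cast card_union_le _ _
      have h2 : (#L : ℝ) ≤ φ ^ 2 := by exact_mod_cast hcard.le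
      have h3 : (0 : ℝ) ≤ (f + 1) / (φ - 1) := by positivity
      simp only [card_empty, Nat.cast_zero]
      linarith
  · obtain ⟨A, hAL, hA⟩ := exists_subset_card_eq (not_lt.1 hcard)
    obtain ⟨P, hPL, hP, hcov⟩ := exists_sparse_cover (by omega : 0 < φ) A L
    have hUT : P + A ⊆ T := by
      intro u hu
      obtain ⟨p, hp, a, ha, rfl⟩ := mem_add.1 hu
      have h1 := mem_filter.1 (hPL hp)
      have h2 := mem_filter.1 (hAL ha)
      exact hT p h1.1 a h2.1 (by omega)
    have hUf : #(P + A) ≤ f + 1 := by simpa using card_le_card (hUT.trans hTf)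
    refine ⟨A, P, (hAL.trans hLT).trans hTf, (hPL.trans hLT).trans hTf, hA.le, hP.trans hUf,
      ?_, ?_, ?_⟩
    · rwa [containerLower, if_pos hA]
    · intro x hx
      rw [containerUpper, if_pos hA, mem_union]
      by_cases h : x ∈ L
      · have := (mem_filter.1 h).2
        exact Or.inr (mem_filter.2 ⟨mem_range.2 (by omega), hcov x h⟩)
      · exact Or.inl (hsplit x hx h)
    · rw [containerUpper, if_pos hA, containerLower, if_pos hA]
      set D := (range (f / 2 + 1)).filter fun x => #(({x} + A) \ (P + A)) < φ with hD
      have h1 : (#(Ioc (f / 2) f ∪ D) : ℝ) ≤ #(Ioc (f / 2) f) + #D := by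
        exact_mod_cast card_union_le _ _
      have h2 := card_mul_le_of_translates_covered hA (D := D) (U := P + A)
        (fun x hx => (mem_filter.1 hx).2)
      have h3 : #D * (φ - 1) ≤ #(P + A) * φ := by
        have e : φ ^ 2 - φ = (φ - 1) * φ := by rw [Nat.sub_mul, one_mul, sq]
        rw [e, sq, ← mul_assoc, ← mul_assoc] at h2
        exact Nat.le_of_mul_le_mul_right h2 (by omega)
      have h4 : (#D : ℝ) * (φ - 1) ≤ #(P + A) * φ := by
        have := (Nat.cast_le (α := ℝ)).2 h3
        push_cast [Nat.cast_sub (by omega : 1 ≤ φ)] at this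
        exact this
      have h5 : (#(P + A) : ℝ) ≤ f + 1 := by exact_mod_cast hUf
      have h6 : (#D : ℝ) ≤ #(P + A) + (f + 1) / (φ - 1) := by
        rw [← sub_le_iff_le_add', le_div_iff₀ hφ']
        linarith
      have h7 : (0 : ℝ) ≤ (φ : ℝ) ^ 2 := by positivity
      linarith

/-- Weight each set `S` by `x ^ #S`. With `x = 1 / φ` this makes the number of fingerprints
subexponential as `φ` grows. -/
lemma card_filter_card_le_mul_pow_le {x : ℝ} (hx : 0 < x) (hx1 : x ≤ 1) (n k : ℕ) :
    (#((range n).powerset.filter fun S => #S ≤ k) : ℝ) * x ^ k ≤ (1 + x) ^ n := by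
  calc (#((range n).powerset.filter fun S => #S ≤ k) : ℝ) * x ^ k
      = ∑ S ∈ (range n).powerset.filter (fun S => #S ≤ k), x ^ k := by simp
    _ ≤ ∑ S ∈ (range n).powerset.filter (fun S => #S ≤ k), x ^ #S :=
        sum_le_sum fun S hS => pow_le_pow_of_le_one hx.le hx1 (mem_filter.1 hS).2
    _ ≤ ∑ S ∈ (range n).powerset, x ^ #S :=
        sum_le_sum_of_subset_of_nonneg (filter_subset _ _) fun _ _ _ => by positivity
    _ = (1 + x) ^ n := by
        have := sum_pow_mul_eq_add_pow x 1 (range n)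
        simpa [add_comm] using this

end Containers

/-! ### Counting closed sets inside a container. -/

section Counting

open Finset

/-- In logarithms: the concave function `log (x + 1)` lies, at integers, below the line through its
points at `s` and `s + 1`. On either side of `s` this is Bernoulli's inequality, for `ρ` or for
`ρ⁻¹`. -/
lemma succ_mul_pow_le (s n : ℕ) :
    ((n : ℝ) + 1) * (((s : ℝ) + 2) / (s + 1)) ^ s ≤ (s + 1) * (((s : ℝ) + 2) / (s + 1)) ^ n := by
  have hs : (0 : ℝ) < s + 1 := by positivity
  have hs2 : (0 : ℝ) < s + 2 := by positivity
  set ρ : ℝ := ((s : ℝ) + 2) / (s + 1) with hρ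
  have hρ0 : 0 < ρ := by positivity
  rcases le_total s n with h | h
  · obtain ⟨k, rfl⟩ := Nat.exists_eq_add_of_le h
    have h1 : 1 + (k : ℝ) * (1 / (s + 1)) ≤ ρ ^ k := by
      have e : ρ = 1 + 1 / ((s : ℝ) + 1) := by rw [hρ]; field_simp; ring
      rw [e]
      exact one_add_mul_le_pow (le_trans (by norm_num) (by positivity : (0 : ℝ) ≤ 1 / (s + 1))) k
    have h2 : ((s + k : ℕ) : ℝ) + 1 = (s + 1) * (1 + (k : ℝ) * (1 / (s + 1))) := by
      push_cast; field_simp; ring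
    rw [h2, pow_add, mul_comm (ρ ^ s), ← mul_assoc]
    gcongr
  · obtain ⟨k, rfl⟩ := Nat.exists_eq_add_of_le h
    have h1 : 1 + (k : ℝ) * (-(1 / (((n + k : ℕ) : ℝ) + 2))) ≤ (ρ⁻¹) ^ k := by
      have e : ρ⁻¹ = 1 + -(1 / (((n + k : ℕ) : ℝ) + 2)) := by
        rw [hρ, inv_div]; field_simp; ring
      rw [e]
      refine one_add_mul_le_pow ?_ k
      have : 1 / (((n + k : ℕ) : ℝ) + 2) ≤ 1 := by
        rw [div_le_one hs2]; linarith
      linarith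
    have h2 : (n : ℝ) + 1 ≤ (((n + k : ℕ) : ℝ) + 1) *
        (1 + (k : ℝ) * (-(1 / (((n + k : ℕ) : ℝ) + 2)))) := by
      have e : (((n + k : ℕ) : ℝ) + 1) * (1 + (k : ℝ) * (-(1 / (((n + k : ℕ) : ℝ) + 2)))) =
          n + 1 + k / (((n + k : ℕ) : ℝ) + 2) := by
        field_simp; push_cast; ring
      rw [e]
      have : (0 : ℝ) ≤ k / (((n + k : ℕ) : ℝ) + 2) := by positivity
      linarith
    have h3 : (n : ℝ) + 1 ≤ (((n + k : ℕ) : ℝ) + 1) * (ρ⁻¹) ^ k :=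
      h2.trans (by gcongr)
    calc ((n : ℝ) + 1) * ρ ^ (n + k)
        ≤ ((((n + k : ℕ) : ℝ) + 1) * (ρ⁻¹) ^ k) * ρ ^ (n + k) := by gcongr
      _ = _ := by rw [pow_add, inv_pow]; field_simp

/-- Up-closed sets along the progressions modulo `m` are determined by their numbers of elements
in the residue classes. -/
lemma subset_of_card_filter_mod_eq {m f : ℕ} {T T' : Finset ℕ} (hTf : T ⊆ range (f + 1))
    (hT : ∀ x ∈ T, ∀ j, x + j * m ≤ f → x + j * m ∈ T)
    (hT' : ∀ x ∈ T', ∀ j, x + j * m ≤ f → x + j * m ∈ T') (hT'f : T' ⊆ range (f + 1))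
    (h : ∀ i, #(T.filter (· % m = i)) = #(T'.filter (· % m = i))) : T ⊆ T' := by
  have up : ∀ {S : Finset ℕ}, (∀ x ∈ S, ∀ j, x + j * m ≤ f → x + j * m ∈ S) →
      ∀ x ∈ S, ∀ y, y ≤ f → x ≤ y → x % m = y % m → y ∈ S := by
    intro S hS x hx y hy hxy hmod
    obtain ⟨j, hj⟩ := (Nat.modEq_iff_dvd' hxy).1 hmod
    have : y = x + j * m := by rw [mul_comm]; omega
    rw [this] at hy ⊢
    exact hS x hx j hy
  intro x hx
  by_contra hx'
  -- Since `x ∉ T'`, the elements of `T'` in the class of `x` all lie above `x`, hence in `T`. The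
  -- class counts would then differ.
  have hlt : T'.filter (· % m = x % m) ⊂ T.filter (· % m = x % m) := by
    refine Finset.ssubset_iff_subset_ne.2 ⟨fun y hy => ?_, fun he => ?_⟩
    · rw [mem_filter] at hy ⊢
      refine ⟨?_, hy.2⟩
      have hyf := mem_range.1 (hT'f hy.1)
      have hxf := mem_range.1 (hTf hx)
      rcases le_total x y with hxy | hxy
      · exact up hT x hx y (by omega) hxy hy.2.symm
      · exact absurd (up hT' y hy.1 x (by omega) hxy hy.2) hx'
    · have : x ∈ T'.filter (· % m = x % m) := he ▸ mem_filter.2 ⟨hx, rfl⟩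
      exact hx' (mem_filter.1 this).1
  exact (card_lt_card hlt).ne (h _).symm

/-- Each class count ranges over an interval. The chord bound is exponential in the interval
lengths, so the product over classes depends only on their sum `#D - #U`. -/
lemma card_between_mul_pow_le (s : ℕ) {m f : ℕ} (hm : 0 < m) (U D : Finset ℕ)
    (𝒯 : Finset (Finset ℕ))
    (h𝒯 : ∀ T ∈ 𝒯, T ⊆ range (f + 1) ∧ (∀ x ∈ T, ∀ j, x + j * m ≤ f → x + j * m ∈ T) ∧
      U ⊆ T ∧ T ⊆ D) :
    (#𝒯 : ℝ) * (((s : ℝ) + 2) / (s + 1)) ^ (s * m) ≤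
      (s + 1) ^ m * (((s : ℝ) + 2) / (s + 1)) ^ (#D - #U) := by
  set ρ : ℝ := ((s : ℝ) + 2) / (s + 1) with hρ
  have hρ0 : 0 < ρ := by positivity
  rcases 𝒯.eq_empty_or_nonempty with rfl | ⟨T₀, hT₀⟩
  · simp only [card_empty, Nat.cast_zero, zero_mul]; positivity
  have hUD : U ⊆ D := (h𝒯 T₀ hT₀).2.2.1.trans (h𝒯 T₀ hT₀).2.2.2
  let c : Finset ℕ → Fin m → ℕ := fun S i => #(S.filter (· % m = i))
  have hc : ∀ {S S' : Finset ℕ}, S ⊆ S' → ∀ i, c S i ≤ c S' i := fun h i =>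
    card_le_card (filter_subset_filter _ h)
  have hsum : ∀ S, ∑ i, c S i = #S := fun S => by
    rw [card_eq_sum_card_fiberwise (f := fun x => (⟨x % m, Nat.mod_lt _ hm⟩ : Fin m))
      (t := univ) (fun _ _ => by simp)]
    refine sum_congr rfl fun i _ => ?_
    simp only [c, Fin.ext_iff]
  have hcard : #𝒯 ≤ ∏ i, (c D i - c U i + 1) := by
    have : #𝒯 ≤ #(Fintype.piFinset fun i => Icc (c U i) (c D i)) := by
      refine card_le_card_of_injOn c (fun T hT => ?_) (fun T hT T' hT' h => ?_)
      · exact mem_coe.2 (Fintype.mem_piFinset.2 fun i =>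
          mem_Icc.2 ⟨hc (h𝒯 T hT).2.2.1 i, hc (h𝒯 T hT).2.2.2 i⟩)
      · have key : ∀ i, #(T.filter (· % m = i)) = #(T'.filter (· % m = i)) := fun i => by
          by_cases hi : i < m
          · exact congrFun h ⟨i, hi⟩
          · have : ∀ S : Finset ℕ, S.filter (· % m = i) = ∅ := fun S =>
              filter_eq_empty_iff.2 fun x _ hx => hi (hx ▸ Nat.mod_lt _ hm)
            rw [this, this]
        obtain ⟨h1, h2, -⟩ := h𝒯 T hT
        obtain ⟨h1', h2', -⟩ := h𝒯 T' hT'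
        exact (subset_of_card_filter_mod_eq h1 h2 h2' h1' key).antisymm
          (subset_of_card_filter_mod_eq h1' h2' h2 h1 fun i => (key i).symm)
    refine this.trans_eq ?_
    rw [Fintype.card_piFinset]
    refine prod_congr rfl fun i _ => ?_
    have := hc hUD i
    rw [Nat.card_Icc]
    omega
  calc (#𝒯 : ℝ) * ρ ^ (s * m)
      ≤ (∏ i, ((c D i - c U i : ℕ) + 1 : ℝ)) * ∏ _i : Fin m, ρ ^ s := by
        rw [prod_const, card_univ, Fintype.card_fin, pow_mul]
        gcongr
        exact_mod_cast hcard
    _ = ∏ i, (((c D i - c U i : ℕ) + 1 : ℝ) * ρ ^ s) := prod_mul_distrib.symm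
    _ ≤ ∏ i, (((s : ℝ) + 1) * ρ ^ (c D i - c U i)) :=
        prod_le_prod (fun _ _ => by positivity) fun i _ => succ_mul_pow_le s _
    _ = (s + 1) ^ m * ρ ^ (#D - #U) := by
        rw [prod_mul_distrib, prod_const, card_univ, Fintype.card_fin, prod_pow_eq_pow_sum,
          sum_tsub_distrib _ fun i _ => hc hUD i, hsum, hsum]

open Classical in
/-- The traces on `[0, f]` of submonoids of `ℕ` containing `m` are among these sets. -/
noncomputable def closedSets (f m : ℕ) : Finset (Finset ℕ) :=
  (range (f + 1)).powerset.filter fun T =>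
    (∀ x ∈ T, ∀ y ∈ T, x + y ≤ f → x + y ∈ T) ∧ m ∈ T

lemma add_mul_mem_of_closed {f m : ℕ} {T : Finset ℕ}
    (hT : ∀ x ∈ T, ∀ y ∈ T, x + y ≤ f → x + y ∈ T) (hm : m ∈ T) {x : ℕ} (hx : x ∈ T) (j : ℕ)
    (h : x + j * m ≤ f) : x + j * m ∈ T := by
  induction j with
  | zero => simpa using hx
  | succ j ih =>
    rw [add_mul, one_mul, ← add_assoc] at h ⊢
    exact hT _ (ih (by omega)) _ hm h

lemma card_closedSets_le (s : ℕ) {f m φ k : ℕ} (hm : 0 < m) (hφ : 2 ≤ φ) (hk : φ ^ 2 ≤ k)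
    (hk' : (f + 1) / φ ≤ k) :
    (#(closedSets f m) : ℝ) * (((s : ℝ) + 2) / (s + 1)) ^ (s * m) ≤
      (#((range (f + 1)).powerset.filter fun S => #S ≤ k) : ℝ) ^ 2 * ((s + 1) ^ m *
        (((s : ℝ) + 2) / (s + 1)) ^ ((f + 1) / 2 + φ ^ 2 + (f + 1) / (φ - 1) : ℝ)) := by
  classical
  set ρ : ℝ := ((s : ℝ) + 2) / (s + 1) with hρ
  have hρ0 : 0 < ρ := by positivity
  have hρ1 : 1 ≤ ρ := by rw [hρ, one_le_div (by positivity)]; linarith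
  set B : ℝ := (f + 1) / 2 + φ ^ 2 + (f + 1) / (φ - 1) with hB
  set 𝒦 := (range (f + 1)).powerset.filter fun S => #S ≤ k with h𝒦
  let 𝒞 := (𝒦 ×ˢ 𝒦).filter fun AP =>
    (#(containerUpper φ f AP.1 AP.2) : ℝ) ≤ #(containerLower φ AP.1 AP.2) + B
  let 𝒯 : Finset ℕ × Finset ℕ → Finset (Finset ℕ) := fun AP => (closedSets f m).filter fun T =>
    containerLower φ AP.1 AP.2 ⊆ T ∧ T ⊆ containerUpper φ f AP.1 AP.2
  have hcover : closedSets f m ⊆ 𝒞.biUnion 𝒯 := by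
    intro T hT
    have hT' := hT
    simp only [closedSets, mem_filter, mem_powerset] at hT'
    obtain ⟨A, P, hA, hP, hAc, hPc, hU, hD, hUD⟩ := exists_container hφ hT'.1 hT'.2.1
    refine mem_biUnion.2 ⟨(A, P), ?_, mem_filter.2 ⟨hT, hU, hD⟩⟩
    refine mem_filter.2 ⟨mem_product.2 ⟨?_, ?_⟩, hUD⟩
    · exact mem_filter.2 ⟨mem_powerset.2 hA, hAc.trans hk⟩
    · exact mem_filter.2 ⟨mem_powerset.2 hP,
        ((Nat.le_div_iff_mul_le (by omega)).2 hPc).trans hk'⟩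
  have h1 : (#(closedSets f m) : ℝ) ≤ ∑ AP ∈ 𝒞, (#(𝒯 AP) : ℝ) := by
    exact_mod_cast (card_le_card hcover).trans card_biUnion_le
  have h2 : ∀ AP ∈ 𝒞, (#(𝒯 AP) : ℝ) * ρ ^ (s * m) ≤ (s + 1) ^ m * ρ ^ B := by
    intro AP hAP
    refine (card_between_mul_pow_le s (f := f) hm (containerLower φ AP.1 AP.2)
      (containerUpper φ f AP.1 AP.2) (𝒯 AP) fun T hT => ?_).trans ?_
    · obtain ⟨hT, hU, hD⟩ := mem_filter.1 hT
      simp only [closedSets, mem_filter, mem_powerset] at hT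
      exact ⟨hT.1, fun x hx j hj => add_mul_mem_of_closed hT.2.1 hT.2.2 hx j hj, hU, hD⟩
    · rw [← hρ, ← Real.rpow_natCast ρ]
      have hB0 : 0 ≤ B := by
        have : (2 : ℝ) ≤ φ := by exact_mod_cast hφ
        have : (0 : ℝ) ≤ (f + 1) / (φ - 1) := div_nonneg (by positivity) (by linarith)
        positivity
      have hle : ((#(containerUpper φ f AP.1 AP.2) - #(containerLower φ AP.1 AP.2) : ℕ) : ℝ)
          ≤ B := by
        have := (mem_filter.1 hAP).2
        -- Natural subtraction truncates at `0`, which is why `0 ≤ B` is needed.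
        rcases le_total #(containerLower φ AP.1 AP.2) #(containerUpper φ f AP.1 AP.2) with h | h
        · rw [Nat.cast_sub h]; linarith
        · rw [Nat.sub_eq_zero_of_le h]; simpa using hB0
      gcongr
  calc (#(closedSets f m) : ℝ) * ρ ^ (s * m)
      ≤ (∑ AP ∈ 𝒞, (#(𝒯 AP) : ℝ)) * ρ ^ (s * m) := by gcongr
    _ = ∑ AP ∈ 𝒞, (#(𝒯 AP) : ℝ) * ρ ^ (s * m) := sum_mul ..
    _ ≤ #𝒞 • ((s + 1) ^ m * ρ ^ B) := sum_le_card_nsmul _ _ _ h2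
    _ ≤ (#𝒦 : ℝ) ^ 2 * ((s + 1) ^ m * ρ ^ B) := by
        rw [nsmul_eq_mul]
        gcongr
        rw [sq]
        exact_mod_cast (card_filter_le _ _).trans_eq (card_product _ _)

end Counting

/-! ### The upper bound. -/

section UpperBound

open Finset

namespace IsNumericalSemigroup

lemma mem_of_frobenius_eq {Λ : AddSubmonoid ℕ} {f x : ℕ} (h : frobenius Λ = f) (hx : f < x) :
    x ∈ Λ := by
  have hc : conductor Λ = f + 1 := by unfold frobenius at h; omega
  have hne : {c : ℕ | ∀ n : ℕ, c + n ∈ Λ}.Nonempty :=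
    Nat.nonempty_of_pos_sInf (by unfold conductor at hc; omega)
  have := Nat.sInf_mem hne (x - (f + 1))
  change conductor Λ + _ ∈ Λ at this
  rwa [hc, Nat.add_sub_cancel' (by omega)] at this

lemma multiplicity_mem_and_ne_zero {Λ : AddSubmonoid ℕ} {f : ℕ} (h : frobenius Λ = f) :
    multiplicity Λ ∈ Λ ∧ multiplicity Λ ≠ 0 :=
  Nat.sInf_mem (s := {n : ℕ | n ∈ Λ ∧ n ≠ 0})
    ⟨f + 1, mem_of_frobenius_eq h (by omega), by omega⟩

lemma mul_multiplicity_le {Λ : AddSubmonoid ℕ} {f n : ℕ} (h : frobenius Λ = f)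
    (hd : depth Λ = n + 1) : n * multiplicity Λ ≤ f := by
  have hc : conductor Λ = f + 1 := by unfold frobenius at h; omega
  have hm := (multiplicity_mem_and_ne_zero h).2
  have : n < depth Λ := by omega
  rw [depth, Nat.lt_ceil, hc, lt_div_iff₀ (by positivity)] at this
  have : n * multiplicity Λ < f + 1 := by exact_mod_cast this
  omega

end IsNumericalSemigroup

open IsNumericalSemigroup in
lemma injOn_trace (f : ℕ) :
    Set.InjOn (fun Λ : AddSubmonoid ℕ => {x ∈ Set.Iic f | x ∈ Λ})
      {Λ | IsNumericalSemigroup.frobenius Λ = f} := by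
  intro Λ hf Λ' hf' h
  ext x
  by_cases hx : x ≤ f
  · simpa [hx] using Set.ext_iff.1 h x
  · simp [mem_of_frobenius_eq hf (not_le.1 hx), mem_of_frobenius_eq hf' (not_le.1 hx)]

lemma finite_setOf_frobenius_eq (f : ℕ) :
    {Λ : AddSubmonoid ℕ | IsNumericalSemigroup.frobenius Λ = f}.Finite :=
  Set.Finite.of_injOn (t := (Set.Iic f).powerset) (fun _ _ => Set.sep_subset _ _) (injOn_trace f)
    (Set.finite_Iic f).powerset

open IsNumericalSemigroup in
lemma frobeniusDepthCount_le_sum {n : ℕ} (hn : 1 ≤ n) (f : ℕ) :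
    frobeniusDepthCount (n + 1) f ≤
      ∑ m ∈ (range (f + 1)).filter (fun m => 0 < m ∧ n * m ≤ f), #(closedSets f m) := by
  classical
  refine le_trans ?_ card_biUnion_le
  rw [frobeniusDepthCount, ← Set.ncard_coe_finset]
  refine Set.ncard_le_ncard_of_injOn (fun Λ => (range (f + 1)).filter (· ∈ Λ)) ?_ ?_
    (Finset.finite_toSet _)
  · rintro Λ ⟨-, hf, hd⟩
    have hm := multiplicity_mem_and_ne_zero hf
    have hnm := mul_multiplicity_le hf hd
    have hmf : multiplicity Λ < f + 1 := Nat.lt_succ_of_le ((Nat.le_mul_of_pos_left _ hn).trans hnm)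
    refine mem_coe.2 (mem_biUnion.2 ⟨multiplicity Λ, ?_, ?_⟩)
    · simp only [mem_filter, mem_range]
      exact ⟨hmf, by omega, hnm⟩
    · simp only [closedSets, mem_filter, mem_powerset, mem_range]
      exact ⟨filter_subset _ _, fun x hx y hy hxy => ⟨by omega, Λ.add_mem hx.2 hy.2⟩, hmf, hm.1⟩
  · rintro Λ ⟨-, hf, -⟩ Λ' ⟨-, hf', -⟩ h
    refine injOn_trace f hf hf' (Set.ext fun x => ?_)
    have := Finset.ext_iff.1 h x
    simpa [Nat.lt_succ_iff] using this

lemma log_card_small_subsets_le {φ : ℕ} (hφ : 2 ≤ φ) (f : ℕ) :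
    Real.log #((range (f + 1)).powerset.filter fun S => #S ≤ (f + 1) / φ + φ ^ 2) ≤
      (f + 1) * (φ : ℝ)⁻¹ + ((f + 1) * (φ : ℝ)⁻¹ + φ ^ 2) * Real.log φ := by
  have hφ1 : (1 : ℝ) ≤ φ := by exact_mod_cast (by omega : 1 ≤ φ)
  have hφ0 : (0 : ℝ) < φ := by linarith
  set k := (f + 1) / φ + φ ^ 2 with hk
  have hpos : 0 < #((range (f + 1)).powerset.filter fun S => #S ≤ k) :=
    card_pos.2 ⟨∅, by simp⟩
  have h := card_filter_card_le_mul_pow_le (inv_pos.2 hφ0) (inv_le_one_of_one_le₀ hφ1) (f + 1) k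
  have hpos' : (0 : ℝ) < #((range (f + 1)).powerset.filter fun S => #S ≤ k) := by
    exact_mod_cast hpos
  have h1 := Real.log_le_log (by positivity) h
  rw [Real.log_mul hpos'.ne' (by positivity), Real.log_pow, Real.log_pow, Real.log_inv] at h1
  have h2 : Real.log (1 + (φ : ℝ)⁻¹) ≤ (φ : ℝ)⁻¹ := by
    have := Real.log_le_sub_one_of_pos (x := 1 + (φ : ℝ)⁻¹) (by positivity)
    linarith
  have h3 : (k : ℝ) ≤ (f + 1) * (φ : ℝ)⁻¹ + φ ^ 2 := by
    have := Nat.cast_div_le (α := ℝ) (m := f + 1) (n := φ)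
    rw [hk]
    push_cast at this ⊢
    rw [div_eq_mul_inv] at this
    linarith
  have h4 : 0 ≤ Real.log φ := Real.log_nonneg hφ1
  have h5 := mul_le_mul_of_nonneg_right h3 h4
  have h6 : ((f + 1 : ℕ) : ℝ) * Real.log (1 + (φ : ℝ)⁻¹) ≤ (f + 1) * (φ : ℝ)⁻¹ := by
    push_cast
    gcongr
  linarith

lemma depthConst_sq (n : ℕ) :
    depthConst n ^ 2 = ((n / 2 : ℕ) + 1 : ℝ) * ((n - n / 2 : ℕ) + 1) := by
  have h : ⌊((n : ℝ) + 2) ^ 2 / 4⌋₊ = (n / 2 + 1) * (n - n / 2 + 1) := by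
    have e : ((n : ℝ) + 2) ^ 2 / 4 = (((n + 2) ^ 2 : ℕ) : ℝ) / ((4 : ℕ) : ℝ) := by push_cast; ring
    rw [e, Nat.floor_div_eq_div]
    obtain ⟨t, rfl | rfl⟩ := Nat.even_or_odd' n
    · have h1 : 2 * t / 2 = t := by omega
      have h2 : 2 * t - t = t := by omega
      rw [h1, h2]
      exact Nat.div_eq_of_eq_mul_left (by norm_num) (by ring)
    · have h1 : (2 * t + 1) / 2 = t := by omega
      have h2 : 2 * t + 1 - t = t + 1 := by omega
      rw [h1, h2]
      rw [show (2 * t + 1 + 2) ^ 2 = 1 + (t + 1) * (t + 1 + 1) * 4 by ring]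
      omega
  rw [depthConst, Real.sq_sqrt (by positivity), h]
  push_cast
  ring

lemma one_lt_depthConst {n : ℕ} (hn : 1 ≤ n) : 1 < depthConst n := by
  have h := depthConst_sq n
  have h0 : 0 ≤ depthConst n := Real.sqrt_nonneg _
  have h1 : (1 : ℝ) ≤ (n - n / 2 : ℕ) := by exact_mod_cast (by omega : 1 ≤ n - n / 2)
  have h2 : (0 : ℝ) ≤ (n / 2 : ℕ) := by positivity
  nlinarith

/-- The right side is the chord of `log (x + 1)` on `[s, s + 1]`, `s = n / 2`, evaluated at the real
number `n / 2`: an endpoint for even `n`, the midpoint for odd `n`. -/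
lemma log_depthConst {n : ℕ} (hn : 1 ≤ n) :
    Real.log (depthConst n) = Real.log ((n / 2 : ℕ) + 1) +
      ((n : ℝ) / 2 - (n / 2 : ℕ)) * Real.log ((((n / 2 : ℕ) : ℝ) + 2) / ((n / 2 : ℕ) + 1)) := by
  have h := congrArg Real.log (depthConst_sq n)
  rw [Real.log_pow, Real.log_mul (by positivity) (by positivity)] at h
  rw [Real.log_div (by positivity) (by positivity)]
  obtain ⟨t, rfl | rfl⟩ := Nat.even_or_odd' n
  · have h1 : 2 * t / 2 = t := by omega
    have h2 : 2 * t - t = t := by omega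
    rw [h1, h2] at h
    rw [h1]
    push_cast at h ⊢
    ring_nf at h ⊢
    linarith
  · have h1 : (2 * t + 1) / 2 = t := by omega
    have h2 : 2 * t + 1 - t = t + 1 := by omega
    rw [h1, h2] at h
    rw [h1]
    push_cast at h ⊢
    rw [add_assoc (t : ℝ) 1 1, one_add_one_eq_two] at h
    linarith

lemma log_closedSets_le {n f m φ : ℕ} (hn : 1 ≤ n) (hm : 0 < m) (hnm : n * m ≤ f) (hφ : 2 ≤ φ)
    (hpos : 0 < #(closedSets f m)) :
    Real.log #(closedSets f m) ≤ f / n * Real.log (depthConst n) +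
      2 * ((f + 1) * (φ : ℝ)⁻¹ + ((f + 1) * (φ : ℝ)⁻¹ + φ ^ 2) * Real.log φ) +
      (1 / 2 + φ ^ 2 + (f + 1) / (φ - 1)) *
        Real.log ((((n / 2 : ℕ) : ℝ) + 2) / ((n / 2 : ℕ) + 1)) := by
  have hK := log_card_small_subsets_le hφ f
  have h := card_closedSets_le (n / 2) hm hφ (Nat.le_add_left (φ ^ 2) ((f + 1) / φ))
    (Nat.le_add_right ((f + 1) / φ) (φ ^ 2))
  rw [log_depthConst hn]
  set s := n / 2 with hs
  set ρ : ℝ := ((s : ℝ) + 2) / (s + 1) with hρ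
  set K := #((range (f + 1)).powerset.filter fun S => #S ≤ (f + 1) / φ + φ ^ 2) with hKdef
  have hK0 : 0 < K := card_pos.2 ⟨∅, by simp⟩
  have hK0' : (0 : ℝ) < K := by exact_mod_cast hK0
  have hρ0 : 0 < ρ := by positivity
  have hpos' : (0 : ℝ) < #(closedSets f m) := by exact_mod_cast hpos
  have h1 := Real.log_le_log (by positivity) h
  rw [Real.log_mul (by positivity) (by positivity), Real.log_mul (by positivity) (by positivity),
    Real.log_mul (by positivity) (by positivity), Real.log_pow, Real.log_pow, Real.log_pow,
    Real.log_rpow hρ0] at h1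
  have hn0 : (0 : ℝ) < n := by exact_mod_cast hn
  -- This is the coefficient of `m` in the bound; being nonnegative, it allows `m` to be replaced by
  -- `f / n`. It is the chord's value at `0`.
  have hslope : 0 ≤ Real.log (s + 1) - s * Real.log ρ := by
    have h2 := succ_mul_pow_le s 0
    rw [← hρ, pow_zero, Nat.cast_zero, zero_add, one_mul, mul_one] at h2
    have h3 := Real.log_le_log (by positivity) h2
    rw [Real.log_pow] at h3
    linarith
  have hmf : (m : ℝ) ≤ f / n := by
    rw [le_div_iff₀ hn0]
    exact_mod_cast (mul_comm n m) ▸ hnm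
  have h4 := mul_le_mul_of_nonneg_right hmf hslope
  have h5 : (f : ℝ) / n * ((n : ℝ) / 2 * Real.log ρ) = f / 2 * Real.log ρ := by field_simp
  push_cast at h1
  linarith

lemma log_frobeniusDepthCount_le {n f φ : ℕ} (hn : 1 ≤ n) (hφ : 2 ≤ φ)
    (hpos : 0 < frobeniusDepthCount (n + 1) f) :
    Real.log (frobeniusDepthCount (n + 1) f) ≤ Real.log (f + 1) +
      (f / n * Real.log (depthConst n) +
      2 * ((f + 1) * (φ : ℝ)⁻¹ + ((f + 1) * (φ : ℝ)⁻¹ + φ ^ 2) * Real.log φ) +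
      (1 / 2 + φ ^ 2 + (f + 1) / (φ - 1)) *
        Real.log ((((n / 2 : ℕ) : ℝ) + 2) / ((n / 2 : ℕ) + 1))) := by
  set E : ℝ := f / n * Real.log (depthConst n) +
      2 * ((f + 1) * (φ : ℝ)⁻¹ + ((f + 1) * (φ : ℝ)⁻¹ + φ ^ 2) * Real.log φ) +
      (1 / 2 + φ ^ 2 + (f + 1) / (φ - 1)) *
        Real.log ((((n / 2 : ℕ) : ℝ) + 2) / ((n / 2 : ℕ) + 1)) with hE
  have h1 : (frobeniusDepthCount (n + 1) f : ℝ) ≤ (f + 1) * Real.exp E := by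
    calc (frobeniusDepthCount (n + 1) f : ℝ)
        ≤ ∑ m ∈ (range (f + 1)).filter (fun m => 0 < m ∧ n * m ≤ f), (#(closedSets f m) : ℝ) := by
          exact_mod_cast frobeniusDepthCount_le_sum hn f
      _ ≤ #((range (f + 1)).filter (fun m => 0 < m ∧ n * m ≤ f)) • Real.exp E := by
          refine sum_le_card_nsmul _ _ _ fun m hm => ?_
          obtain ⟨-, hm0, hnm⟩ := mem_filter.1 hm
          rcases Nat.eq_zero_or_pos #(closedSets f m) with h0 | h0
          · rw [h0, Nat.cast_zero]; positivity
          · rw [← Real.log_le_iff_le_exp (by exact_mod_cast h0)]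
            exact log_closedSets_le hn hm0 hnm hφ h0
      _ ≤ (f + 1) * Real.exp E := by
          rw [nsmul_eq_mul]
          gcongr
          have := card_filter_le (range (f + 1)) (fun m => 0 < m ∧ n * m ≤ f)
          rw [card_range] at this
          exact_mod_cast this
  have h2 := Real.log_le_log (by exact_mod_cast hpos) h1
  rwa [Real.log_mul (by positivity) (by positivity), Real.log_exp] at h2

lemma eventually_log_frobeniusDepthCount_le {n : ℕ} (hn : 1 ≤ n) {δ : ℝ} (hδ : 0 < δ) :
    ∀ᶠ f : ℕ in atTop, 0 < frobeniusDepthCount (n + 1) f →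
      Real.log (frobeniusDepthCount (n + 1) f) ≤ f / n * Real.log (depthConst n) + δ * f := by
  set r : ℝ := Real.log ((((n / 2 : ℕ) : ℝ) + 2) / ((n / 2 : ℕ) + 1)) with hr
  have hlim : Tendsto (fun φ : ℕ => 2 * ((φ : ℝ)⁻¹ + Real.log φ / φ) + ((φ : ℝ) - 1)⁻¹ * r)
      atTop (nhds 0) := by
    have h1 : Tendsto (fun φ : ℕ => (φ : ℝ)⁻¹) atTop (nhds 0) :=
      tendsto_inv_atTop_nhds_zero_nat
    have h2 : Tendsto (fun φ : ℕ => Real.log φ / φ) atTop (nhds 0) :=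
      (Real.isLittleO_log_id_atTop.tendsto_div_nhds_zero).comp tendsto_natCast_atTop_atTop
    have h3 : Tendsto (fun φ : ℕ => ((φ : ℝ) - 1)⁻¹) atTop (nhds 0) :=
      tendsto_inv_atTop_zero.comp (tendsto_atTop_add_const_right _ (-1) tendsto_natCast_atTop_atTop)
    simpa using ((h1.add h2).const_mul 2).add (h3.mul_const r)
  -- `φ` depends on `δ` and `n` but not on `f`, so terms such as `φ ^ 2 * log φ` are constants.
  obtain ⟨φ, hφlim, hφ⟩ :=
    ((hlim.eventually_lt_const (half_pos hδ)).and (eventually_ge_atTop 2)).exists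
  set g : ℝ := 2 * ((φ : ℝ)⁻¹ + Real.log φ / φ) + ((φ : ℝ) - 1)⁻¹ * r with hg
  have hsmall : (fun f : ℕ => Real.log ((f : ℝ) + 1) +
      (g + 2 * φ ^ 2 * Real.log φ + (1 / 2 + φ ^ 2) * r)) =o[atTop] fun f : ℕ => (f : ℝ) := by
    have hcast : Tendsto (fun f : ℕ => (f : ℝ)) atTop atTop := tendsto_natCast_atTop_atTop
    refine IsLittleO.add ?_ (isLittleO_const_left.2 (Or.inr (tendsto_norm_atTop_atTop.comp hcast)))
    have h1 : (fun f : ℕ => Real.log ((f : ℝ) + 1)) =o[atTop] fun f : ℕ => (f : ℝ) + 1 :=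
      Real.isLittleO_log_id_atTop.comp_tendsto (tendsto_atTop_add_const_right _ 1 hcast)
    refine h1.trans_isBigO ((isBigO_refl _ _).add ?_)
    exact (isLittleO_const_left.2 (Or.inr (tendsto_norm_atTop_atTop.comp hcast))).isBigO
  filter_upwards [hsmall.bound (half_pos hδ)] with f hf hpos
  have h := log_frobeniusDepthCount_le hn hφ hpos
  rw [← hr] at h
  have hf' := (le_abs_self _).trans hf
  rw [Real.norm_of_nonneg (Nat.cast_nonneg f)] at hf'
  have hgf : g * f ≤ δ / 2 * f := by gcongr
  have e : 2 * ((f + 1) * (φ : ℝ)⁻¹ + ((f + 1) * (φ : ℝ)⁻¹ + φ ^ 2) * Real.log φ) +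
      (1 / 2 + φ ^ 2 + (f + 1) / (φ - 1)) * r =
      g * f + (g + 2 * φ ^ 2 * Real.log φ + (1 / 2 + φ ^ 2) * r) := by
    rw [hg, div_eq_mul_inv, div_eq_mul_inv]
    ring
  linarith

end UpperBound

/-! ### The lower bound, by explicit Kunz words. -/

section LowerBound

open Finset

lemma mul_add_div_of_lt {a b c : ℕ} (h : c < b) : (a * b + c) / b = a := by
  rw [mul_comm, Nat.mul_add_div (by omega), Nat.div_eq_of_lt h, add_zero]

/-- Conditions under which `k` is the Kunz word of a numerical semigroup with multiplicity `m`
and Frobenius number `n * m + r`, all of whose minimal elements other than `m` exceed half the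
Frobenius number. -/
structure IsHighKunzWord (n m r : ℕ) (k : ℕ → ℕ) : Prop where
  zero : k 0 = 0
  top : k r = n + 1
  pos : ∀ i, 0 < i → i < m → 0 < k i
  le : ∀ i, i < m → k i ≤ n + 1
  le_of_lt : ∀ i, r < i → i < m → k i ≤ n
  high : ∀ i, 0 < i → i < m → n * m + r < 2 * (k i * m + i)

namespace IsHighKunzWord

variable {n m r : ℕ} {k : ℕ → ℕ}

lemma le_div_of_lt (h : IsHighKunzWord n m r k) (hr : r < m) {x : ℕ} (hx : n * m + r < x) :
    k (x % m) ≤ x / m := by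
  have hm : 0 < m := by omega
  have hxm := Nat.mod_lt x hm
  have hdiv := Nat.div_add_mod' x m
  rcases lt_or_ge n (x / m) with h1 | h1
  · exact (h.le _ hxm).trans h1
  · have h2 : n ≤ x / m := (Nat.le_div_iff_mul_le hm).2 (by omega)
    have h3 : x / m = n := le_antisymm h1 h2
    rw [h3] at hdiv ⊢
    exact h.le_of_lt _ (by omega) hxm

/-- The numerical semigroup with a given Kunz word. -/
def semigroup (h : IsHighKunzWord n m r k) (hr : r < m) : AddSubmonoid ℕ where
  carrier := {x | k (x % m) ≤ x / m}
  zero_mem' := by simp [h.zero]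
  add_mem' := by
    intro x y hx hy
    change k (x % m) ≤ x / m at hx
    change k (y % m) ≤ y / m at hy
    change k ((x + y) % m) ≤ (x + y) / m
    have hm : 0 < m := by omega
    rcases Nat.eq_zero_or_pos (x % m) with hx0 | hx0
    · rw [Nat.add_mod, hx0, zero_add, Nat.mod_mod]
      exact hy.trans (Nat.div_le_div_right (by omega))
    rcases Nat.eq_zero_or_pos (y % m) with hy0 | hy0
    · rw [Nat.add_mod, hy0, add_zero, Nat.mod_mod]
      exact hx.trans (Nat.div_le_div_right (by omega))
    -- Members not divisible by `m` exceed half the Frobenius number, so a sum of two of them passes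
    -- it.
    have key : ∀ z, 0 < z % m → k (z % m) ≤ z / m → n * m + r < 2 * z := fun z hz hk => by
      have h1 := h.high _ hz (Nat.mod_lt z hm)
      have h2 := Nat.mul_le_mul_right m hk
      have h3 := Nat.div_add_mod' z m
      omega
    have h1 := key x hx0 hx
    have h2 := key y hy0 hy
    exact h.le_div_of_lt hr (by omega)

lemma mem_semigroup (h : IsHighKunzWord n m r k) (hr : r < m) {x : ℕ} :
    x ∈ h.semigroup hr ↔ k (x % m) ≤ x / m := Iff.rfl

lemma conductor_semigroup (h : IsHighKunzWord n m r k) (hr : r < m) :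
    IsNumericalSemigroup.conductor (h.semigroup hr) = n * m + r + 1 := by
  have h1 : ∀ j, n * m + r + 1 + j ∈ h.semigroup hr := fun j => h.le_div_of_lt hr (by omega)
  refine le_antisymm (Nat.sInf_le h1) (le_csInf ⟨_, h1⟩ fun c hc => ?_)
  by_contra! hlt
  have h2 := hc (n * m + r - c)
  have hm : 0 < m := by omega
  rw [Nat.add_sub_cancel' (by omega), mem_semigroup, Nat.mul_add_mod_of_lt hr,
    mul_add_div_of_lt hr, h.top] at h2
  omega

lemma multiplicity_semigroup (h : IsHighKunzWord n m r k) (hr : r < m) :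
    IsNumericalSemigroup.multiplicity (h.semigroup hr) = m := by
  have hm : 0 < m := by omega
  have h1 : m ∈ h.semigroup hr ∧ m ≠ 0 :=
    ⟨by rw [mem_semigroup, Nat.mod_self, h.zero]; exact Nat.zero_le _, hm.ne'⟩
  refine le_antisymm (Nat.sInf_le h1) (le_csInf ⟨_, h1⟩ fun x hx => ?_)
  by_contra! hlt
  have h2 : k (x % m) ≤ x / m := hx.1
  rw [Nat.mod_eq_of_lt hlt, Nat.div_eq_of_lt hlt] at h2
  have := h.pos x (Nat.pos_of_ne_zero hx.2) hlt
  omega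

lemma semigroup_mem (h : IsHighKunzWord n m r k) (hr : r < m) :
    IsNumericalSemigroup (h.semigroup hr) ∧
      IsNumericalSemigroup.frobenius (h.semigroup hr) = (n * m + r : ℕ) ∧
      IsNumericalSemigroup.depth (h.semigroup hr) = n + 1 := by
  have hm : (0 : ℚ) < m := by exact_mod_cast (by omega : 0 < m)
  refine ⟨(Set.finite_Iic (n * m + r)).subset fun x hx => ?_, ?_, ?_⟩
  · by_contra hlt
    exact hx (h.le_div_of_lt hr (not_le.1 hlt))
  · rw [IsNumericalSemigroup.frobenius, h.conductor_semigroup hr]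
    push_cast
    ring
  · rw [IsNumericalSemigroup.depth, h.conductor_semigroup hr, h.multiplicity_semigroup hr,
      Nat.ceil_eq_iff (by omega), lt_div_iff₀ hm, div_le_iff₀ hm, Nat.add_sub_cancel]
    constructor
    · exact_mod_cast (by omega : n * m < n * m + r + 1)
    · exact_mod_cast (by rw [add_mul, one_mul]; omega : n * m + r + 1 ≤ (n + 1) * m)

end IsHighKunzWord

/-- A whole box of admissible words injects into the semigroups: `k i` is the least `j` with `j * m
+ i` in the semigroup. -/
lemma prod_le_frobeniusDepthCount {n m r : ℕ} (hr : r < m) (a b : ℕ → ℕ)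
    (hab : ∀ k : ℕ → ℕ, (∀ i < m, a i ≤ k i ∧ k i ≤ b i) → IsHighKunzWord n m r k) :
    ∏ i ∈ range m, (b i + 1 - a i) ≤ frobeniusDepthCount (n + 1) (n * m + r) := by
  classical
  let ext : (Fin m → ℕ) → ℕ → ℕ := fun w i => if h : i < m then w ⟨i, h⟩ else 0
  let W := Fintype.piFinset fun i : Fin m => Icc (a i) (b i)
  have hW : ∀ w ∈ W, IsHighKunzWord n m r (ext w) := fun w hw => hab _ fun i hi => by
    have := Fintype.mem_piFinset.1 hw ⟨i, hi⟩
    simpa [ext, hi] using this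
  have hcard : ∏ i ∈ range m, (b i + 1 - a i) = (W : Set (Fin m → ℕ)).ncard := by
    rw [Set.ncard_coe_finset, Fintype.card_piFinset, prod_range]
    simp
  rw [hcard, frobeniusDepthCount]
  refine Set.ncard_le_ncard_of_injOn
    (fun w => if hw : w ∈ W then (hW w hw).semigroup hr else ⊥) (fun w hw => ?_)
    (fun w hw w' hw' h => ?_) ((finite_setOf_frobenius_eq (n * m + r)).subset fun Λ hΛ => hΛ.2.1)
  · rw [mem_coe] at hw
    simp only [dif_pos hw]
    exact (hW w hw).semigroup_mem hr
  · rw [mem_coe] at hw hw'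
    simp only [dif_pos hw, dif_pos hw'] at h
    funext i
    have key : ∀ j, w i ≤ j ↔ w' i ≤ j := fun j => by
      have h1 := SetLike.ext_iff.1 h (j * m + i)
      rw [IsHighKunzWord.mem_semigroup, IsHighKunzWord.mem_semigroup,
        Nat.mul_add_mod_of_lt i.2, mul_add_div_of_lt i.2] at h1
      simpa [ext] using h1
    exact le_antisymm ((key _).2 le_rfl) ((key _).1 le_rfl)

/-- Depth `2` is separate because `s = 0` would allow a zero Kunz coordinate. Taking `m` just above
`f / 2` makes every positive word high, and coordinates `0 < i < r` are free in `{1, 2}`. -/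
lemma two_pow_le_frobeniusDepthCount {f : ℕ} (hf : 3 ≤ f) :
    2 ^ (f - f / 2 - 2) ≤ frobeniusDepthCount 2 f := by
  set m := f / 2 + 1 with hm
  set r := f - f / 2 - 1 with hrdef
  have hfr : 1 * m + r = f := by omega
  have h := prod_le_frobeniusDepthCount (n := 1) (m := m) (r := r) (by omega)
    (fun i => if i = 0 then 0 else if i = r then 2 else 1)
    (fun i => if i = 0 then 0 else if i ≤ r then 2 else 1) (fun k hk => by
      have h0 := hk 0 (by omega)
      have hr := hk r (by omega)
      rw [if_pos rfl] at h0
      rw [if_neg (by omega), if_pos rfl, if_neg (by omega), if_pos le_rfl] at hr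
      have h1 : ∀ i, 0 < i → i < m → 1 ≤ k i ∧ k i ≤ if i ≤ r then 2 else 1 := fun i hi him => by
        have := hk i him
        rw [if_neg hi.ne', if_neg hi.ne'] at this
        refine ⟨le_trans ?_ this.1, this.2⟩
        split_ifs <;> omega
      refine ⟨by simpa using h0, by omega, fun i hi him => (h1 i hi him).1, fun i him => ?_,
        fun i hi him => ?_, fun i hi him => ?_⟩
      · rcases Nat.eq_zero_or_pos i with rfl | hi
        · simp at h0; omega
        · refine (h1 i hi him).2.trans ?_
          split_ifs <;> omega
      · have := (h1 i (by omega) him).2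
        rwa [if_neg (by omega)] at this
      · have := Nat.mul_le_mul_right m (h1 i hi him).1
        omega)
  rw [hfr] at h
  refine le_trans ?_ h
  calc 2 ^ (f - f / 2 - 2) = ∏ i ∈ Ioo 0 r, 2 := by
        rw [prod_const, Nat.card_Ioo]; congr 1
    _ = ∏ i ∈ Ioo 0 r, ((if i = 0 then 0 else if i ≤ r then 2 else 1) + 1 -
          (if i = 0 then 0 else if i = r then 2 else 1)) := by
        refine prod_congr rfl fun i hi => ?_
        rw [mem_Ioo] at hi
        rw [if_neg (by omega : ¬ i = 0), if_neg (by omega : ¬ i = 0), if_pos (by omega : i ≤ r),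
          if_neg (by omega : ¬ i = r)]
    _ ≤ _ := by
        refine prod_le_prod_of_subset_of_one_le' (fun i hi => ?_) fun i hi _ => ?_
        · rw [mem_Ioo] at hi; exact mem_range.2 (by omega)
        · split_ifs <;> omega

lemma pow_le_frobeniusDepthCount {n m r : ℕ} (hn : 2 ≤ n) (hr0 : 0 < r) (hr : r < m) :
    ((n / 2 + 1) * (n - n / 2 + 1)) ^ ((m - r) / 2 - 1) ≤
      frobeniusDepthCount (n + 1) (n * m + r) := by
  set s := n / 2 with hs
  -- Past the midpoint of `(r, m)` the residue makes up for `2 * s` being possibly `n - 1`. Below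
  -- it, `2 * (n - s) ≥ n` is needed.
  let a : ℕ → ℕ := fun i =>
    if i = 0 then 0 else if i ≤ r then n + 1 else if m + r < 2 * i then s else n - s
  let b : ℕ → ℕ := fun i => if i = 0 then 0 else if i ≤ r then n + 1 else n
  have h := prod_le_frobeniusDepthCount (n := n) hr a b (fun k hk => by
    have h0 := hk 0 (by omega)
    have hkr := hk r hr
    simp only [a, b, if_neg hr0.ne', le_refl, if_true] at h0 hkr
    have h1 : ∀ i, 0 < i → i ≤ r → k i = n + 1 := fun i hi hir => by
      have := hk i (by omega)
      simp only [a, b, if_neg hi.ne', if_pos hir] at this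
      omega
    have h2 : ∀ i, r < i → i < m → (if m + r < 2 * i then s else n - s) ≤ k i ∧ k i ≤ n :=
      fun i hi him => by
        have := hk i him
        simpa only [a, b, if_neg (by omega : ¬ i = 0), if_neg (by omega : ¬ i ≤ r)] using this
    refine ⟨by omega, by omega, fun i hi him => ?_, fun i him => ?_,
      fun i hi him => (h2 i hi him).2, fun i hi him => ?_⟩
    · rcases le_or_gt i r with hir | hir
      · rw [h1 i hi hir]; omega
      · refine lt_of_lt_of_le ?_ (h2 i hir him).1
        split_ifs <;> omega
    · rcases Nat.eq_zero_or_pos i with rfl | hi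
      · omega
      · rcases le_or_gt i r with hir | hir
        · rw [h1 i hi hir]
        · have := (h2 i hir him).2; omega
    · rcases le_or_gt i r with hir | hir
      · rw [h1 i hi hir, add_mul, one_mul]; omega
      · have h3 := (h2 i hir him).1
        split_ifs at h3 with hi2
        · have h4 := Nat.mul_le_mul_right m (by omega : n ≤ 2 * k i + 1)
          rw [add_mul, one_mul, mul_assoc] at h4
          omega
        · have h4 := Nat.mul_le_mul_right m (by omega : n ≤ 2 * k i)
          rw [mul_assoc] at h4
          omega)
  refine le_trans ?_ h
  set t := (m + r) / 2 with ht
  have hdisj : Disjoint (Ioc r t) (Ioo t m) := disjoint_left.2 fun i hi hi' => by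
    rw [mem_Ioc] at hi; rw [mem_Ioo] at hi'; omega
  calc ((s + 1) * (n - s + 1)) ^ ((m - r) / 2 - 1)
      = (s + 1) ^ ((m - r) / 2 - 1) * (n - s + 1) ^ ((m - r) / 2 - 1) := mul_pow _ _ _
    _ ≤ (s + 1) ^ #(Ioc r t) * (n - s + 1) ^ #(Ioo t m) := by
        rw [Nat.card_Ioc, Nat.card_Ioo]
        exact Nat.mul_le_mul (Nat.pow_le_pow_right (by omega) (by omega))
          (Nat.pow_le_pow_right (by omega) (by omega))
    _ = (∏ i ∈ Ioc r t, (b i + 1 - a i)) * ∏ i ∈ Ioo t m, (b i + 1 - a i) := by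
        rw [← prod_const, ← prod_const]
        congr 1
        · refine prod_congr rfl fun i hi => ?_
          rw [mem_Ioc] at hi
          simp only [a, b, if_neg (by omega : ¬ i = 0), if_neg (by omega : ¬ i ≤ r),
            if_neg (by omega : ¬ m + r < 2 * i)]
          omega
        · refine prod_congr rfl fun i hi => ?_
          rw [mem_Ioo] at hi
          simp only [a, b, if_neg (by omega : ¬ i = 0), if_neg (by omega : ¬ i ≤ r),
            if_pos (by omega : m + r < 2 * i)]
          omega
    _ = ∏ i ∈ Ioc r t ∪ Ioo t m, (b i + 1 - a i) := (prod_union hdisj).symm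
    _ ≤ _ := by
        refine prod_le_prod_of_subset_of_one_le' (fun i hi => ?_) fun i hi _ => ?_
        · rw [mem_union, mem_Ioc, mem_Ioo] at hi; exact mem_range.2 (by omega)
        · simp only [a, b]
          split_ifs <;> omega

lemma eventually_rpow_le_frobeniusDepthCount {n : ℕ} (hn : 1 ≤ n) :
    ∀ᶠ f : ℕ in atTop,
      depthConst n ^ ((f : ℝ) / n - (n + 4)) ≤ (frobeniusDepthCount (n + 1) f : ℝ) := by
  have hc := one_lt_depthConst hn
  have hsq := depthConst_sq n
  have hc2 : depthConst n ^ 2 = (((n / 2 + 1) * (n - n / 2 + 1) : ℕ) : ℝ) := by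
    rw [hsq]; push_cast; ring
  filter_upwards [eventually_ge_atTop (n * (n + 2) + 3)] with f hf
  suffices h : ∃ L : ℕ, (f : ℝ) / n - (n + 4) ≤ (2 * L : ℕ) ∧
      ((n / 2 + 1) * (n - n / 2 + 1)) ^ L ≤ frobeniusDepthCount (n + 1) f by
    obtain ⟨L, hL, h⟩ := h
    calc depthConst n ^ ((f : ℝ) / n - (n + 4)) ≤ depthConst n ^ ((2 * L : ℕ) : ℝ) :=
          Real.rpow_le_rpow_of_exponent_le hc.le hL
      _ = (((n / 2 + 1) * (n - n / 2 + 1) : ℕ) : ℝ) ^ L := by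
          rw [Real.rpow_natCast, pow_mul, hc2]
      _ ≤ _ := by exact_mod_cast h
  rcases hn.eq_or_lt with rfl | hn2
  · refine ⟨f - f / 2 - 2, ?_, two_pow_le_frobeniusDepthCount (by omega)⟩
    have : (f : ℝ) ≤ (2 * (f - f / 2 - 2) : ℕ) + 5 := by
      exact_mod_cast (by omega : f ≤ 2 * (f - f / 2 - 2) + 5)
    push_cast at this ⊢
    linarith
  -- Dividing `f - 1` rather than `f` puts `r` in `[1, n]`, so the top class is never class `0`.
  · set m := (f - 1) / n with hm
    set r := (f - 1) % n + 1 with hr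
    have hrn : r ≤ n := Nat.mod_lt (f - 1) (by omega)
    have hfr : n * m + r = f := by
      have := Nat.div_add_mod (f - 1) n
      rw [hm, hr]
      omega
    have hnm : n + 2 ≤ m := (Nat.le_div_iff_mul_le (by omega)).2 (by rw [mul_comm]; omega)
    refine ⟨(m - r) / 2 - 1, ?_, ?_⟩
    · have h1 : (f : ℝ) / n ≤ m + 1 := by
        rw [div_le_iff₀ (by positivity)]
        have : f ≤ (m + 1) * n := by rw [add_mul, one_mul, mul_comm]; omega
        exact_mod_cast this
      have h2 : (m : ℝ) ≤ (2 * ((m - r) / 2 - 1) : ℕ) + (n + 3) := by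
        exact_mod_cast (by omega : m ≤ 2 * ((m - r) / 2 - 1) + (n + 3))
      linarith
    · have := pow_le_frobeniusDepthCount (n := n) (m := m) (r := r) hn2 (by omega) (by omega)
      rwa [hfr] at this

end LowerBound

theorem mainTheorem3 (q : ℕ) (hq : 2 ≤ q) :
    ∃ ε : ℕ → ℝ, (ε =o[atTop] fun f : ℕ => (f : ℝ)) ∧
      ∀ᶠ f : ℕ in atTop,
        (frobeniusDepthCount q f : ℝ) =
          depthConst (q - 1) ^ ((f : ℝ) / ((q : ℝ) - 1) + ε f) := by
  obtain ⟨n, rfl⟩ : ∃ n, q = n + 1 := ⟨q - 1, by omega⟩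
  have hn : 1 ≤ n := by omega
  have hc := one_lt_depthConst hn
  have hc0 : 0 < depthConst n := by linarith
  have hlc : 0 < Real.log (depthConst n) := Real.log_pos hc
  simp only [Nat.add_sub_cancel, Nat.cast_add, Nat.cast_one, add_sub_cancel_right]
  have hlow := eventually_rpow_le_frobeniusDepthCount hn
  -- The equation is solved for `ε`; it then holds wherever the count is positive, which the lower
  -- bound ensures eventually.
  refine ⟨fun f => Real.log (frobeniusDepthCount (n + 1) f) / Real.log (depthConst n) - f / n,
    isLittleO_iff.2 fun δ hδ => ?_, ?_⟩
  · have hconst := (tendsto_natCast_atTop_atTop (R := ℝ)).eventually_ge_atTop (((n : ℝ) + 4) / δ)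
    filter_upwards [hlow, hconst,
      eventually_log_frobeniusDepthCount_le hn (mul_pos hδ hlc)] with f h1 h2 h3
    have hpos : (0 : ℝ) < frobeniusDepthCount (n + 1) f := (Real.rpow_pos_of_pos hc0 _).trans_le h1
    have h4 := h3 (by exact_mod_cast hpos)
    have h5 := Real.log_le_log (Real.rpow_pos_of_pos hc0 _) h1
    rw [Real.log_rpow hc0] at h5
    rw [div_le_iff₀ hδ] at h2
    rw [Real.norm_of_nonneg (Nat.cast_nonneg f), Real.norm_eq_abs, abs_le]
    constructor
    · have := (le_div_iff₀ hlc).2 h5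
      linarith
    · rw [sub_le_iff_le_add, div_le_iff₀ hlc]
      linarith
  · filter_upwards [hlow] with f h1
    have hpos : (0 : ℝ) < frobeniusDepthCount (n + 1) f := (Real.rpow_pos_of_pos hc0 _).trans_le h1
    rw [add_sub_cancel, Real.rpow_def_of_pos hc0, mul_div_cancel₀ _ hlc.ne', Real.exp_log hpos]
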